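/- Let $R$ be an associative ring with identity, not necessarily commutative. A minimal injective coresolution of a left $R$-module $M$ is an exact sequence $0\to M\to E^0(M)\to E^1(M)\to\cdots$ of left $R$-modules in which $E^0(M)$ is an injective envelope of $M$ and each $E^{i+1}(M)$ is an injective envelope of the cokernel of the map into $E^i(M)$; it is unique up to isomorphism. The module $M$ is said to satisfy the Auslander condition if, for every $i\geqslant 0$, the flat dimension of $E^i(M)$ is at most $i$. Let $$\mathbf{X}:\ \cdots\to X_{n+1}\xrightarrow{\partial_{n+1}} X_n\xrightarrow{\partial_n} X_{n-1}\to\cdots\qquad(n\in\mathbb{Z})$$ be an exact complex of left $R$-modules such that every term $X_n$ satisfies the Auslander condition. Then, for every $n\in\mathbb{Z}$, the $n$-th cycle $\ker(\partial_n)$ satisfies the Auslander condition. -/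

import Mathlib

open CategoryTheory
open scoped TensorProduct

universe u v

namespace AuslanderCondition

/-! All modules `M` with `Module R M` are left modules; a right `R`-module is a module over
`Rᵐᵒᵖ`, where `MulOpposite.op r • a` is the product `a r`. -/

section Tensor

variable (R : Type u) [Ring R]

/-- The relations `a r ⊗ m = a ⊗ r m` in `A ⊗_ℤ M`, for a right `R`-module `A` and a left
`R`-module `M`. -/
def balancedRelations (A M : Type v) [AddCommGroup A] [Module Rᵐᵒᵖ A]
    [AddCommGroup M] [Module R M] : AddSubgroup (A ⊗[ℤ] M) :=
  AddSubgroup.closure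
    {x | ∃ (a : A) (r : R) (m : M), x = (MulOpposite.op r • a) ⊗ₜ[ℤ] m - a ⊗ₜ[ℤ] (r • m)}

/-- The tensor product `A ⊗_R M` (an abelian group) of a right `R`-module `A` and a left
`R`-module `M`, over a ring `R` that need not be commutative. -/
abbrev BalancedTensor (A M : Type v) [AddCommGroup A] [Module Rᵐᵒᵖ A]
    [AddCommGroup M] [Module R M] : Type v :=
  (A ⊗[ℤ] M) ⧸ balancedRelations R A M

variable {A B : Type v} [AddCommGroup A] [Module Rᵐᵒᵖ A] [AddCommGroup B] [Module Rᵐᵒᵖ B]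

theorem balancedRelations_le_comap (M : Type v) [AddCommGroup M] [Module R M]
    (f : A →ₗ[Rᵐᵒᵖ] B) :
    balancedRelations R A M ≤ (balancedRelations R B M).comap
      (f.toAddMonoidHom.toIntLinearMap.rTensor M).toAddMonoidHom := by
  refine (AddSubgroup.closure_le _).2 ?_
  rintro _ ⟨a, r, m, rfl⟩
  refine AddSubgroup.subset_closure ⟨f a, r, m, ?_⟩
  simp

/-- The homomorphism `f ⊗_R M : A ⊗_R M → B ⊗_R M` induced by an `R`-linear map `f : A → B` of
right `R`-modules. -/
def BalancedTensor.map (M : Type v) [AddCommGroup M] [Module R M] (f : A →ₗ[Rᵐᵒᵖ] B) :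
    BalancedTensor R A M →+ BalancedTensor R B M :=
  QuotientAddGroup.map _ _ (f.toAddMonoidHom.toIntLinearMap.rTensor M).toAddMonoidHom
    (balancedRelations_le_comap R M f)

end Tensor

variable (R : Type u) [Ring R]

/-- A left `R`-module `M` is flat if `- ⊗_R M` preserves injectivity of homomorphisms of right
`R`-modules. -/
def IsFlat (M : Type v) [AddCommGroup M] [Module R M] : Prop :=
  ∀ ⦃A B : Type v⦄ [AddCommGroup A] [Module Rᵐᵒᵖ A] [AddCommGroup B] [Module Rᵐᵒᵖ B]
    (f : A →ₗ[Rᵐᵒᵖ] B), Function.Injective f → Function.Injective (BalancedTensor.map R M f)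

/-- `FlatDimLE R n M` says that the flat dimension of `M` is at most `n`, i.e. that there is an
exact sequence `0 → Fₙ → ⋯ → F₀ → M → 0` with all `Fᵢ` flat. The sequence is given one step at a
time: `M` has such a sequence of length `n + 1` if and only if there is a short exact sequence
`0 → K → F₀ → M → 0` with `F₀` flat such that `K` has one of length `n`. -/
def FlatDimLE : ℕ → ∀ (M : Type v) [AddCommGroup M] [Module R M], Prop
  | 0, M, _, _ => IsFlat R M
  | n + 1, M, _, _ => ∃ (K F : ModuleCat.{v} R) (i : K →ₗ[R] F) (p : F →ₗ[R] M),
      IsFlat R F ∧ Function.Injective i ∧ Function.Exact i p ∧ Function.Surjective p ∧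
        FlatDimLE n K

variable {R}

/-- A submodule `N` of `E` is essential if it meets every nonzero submodule nontrivially. -/
def IsEssential {E : Type v} [AddCommGroup E] [Module R E] (N : Submodule R E) : Prop :=
  ∀ K : Submodule R E, K ⊓ N = ⊥ → K = ⊥

/-- `0 → M → E⁰ → E¹ → ⋯` (with maps `ε`, `d 0`, `d 1`, …) is a minimal injective coresolution of
`M`: it is exact, all `Eⁱ` are injective, and the image of each of the maps `M → E⁰` and
`Eⁱ → Eⁱ⁺¹` is essential in the target. In other words, `E⁰` is an injective envelope of `M`,
and `Eⁱ⁺¹` is an injective envelope of the cokernel of the map into `Eⁱ`. -/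
structure IsMinimalInjectiveCoresolution (M : Type v) [AddCommGroup M] [Module R M]
    (E : ℕ → ModuleCat.{v} R) (ε : M →ₗ[R] E 0) (d : ∀ i, E i →ₗ[R] E (i + 1)) : Prop where
  injective : ∀ i, Module.Injective R (E i)
  injective_ε : Function.Injective ε
  exact_zero : Function.Exact ε (d 0)
  exact_succ : ∀ i, Function.Exact (d i) (d (i + 1))
  essential_zero : IsEssential (LinearMap.range ε)
  essential_succ : ∀ i, IsEssential (LinearMap.range (d i))

variable (R)

/-- `M` satisfies the Auslander condition: its minimal injective coresolution (which is unique up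
to isomorphism) has `i`-th term of flat dimension at most `i`, for every `i ≥ 0`. -/
def SatisfiesAuslanderCondition (M : Type v) [AddCommGroup M] [Module R M] : Prop :=
  ∃ (E : ℕ → ModuleCat.{v} R) (ε : M →ₗ[R] E 0) (d : ∀ i, E i →ₗ[R] E (i + 1)),
    IsMinimalInjectiveCoresolution M E ε d ∧ ∀ i, FlatDimLE R i (E i)

end AuslanderCondition

/-!
Let `Zₙ` be the `n`-th cycle of `X`. As `X` is acyclic, `0 → Zₙ → Xₙ → Zₙ₋₁ → 0` is exact, and then
`Eⁱ(Zₙ)` is a direct summand of `Eⁱ(Xₙ) ⊕ Eⁱ⁻¹(Zₙ₋₁)` for every `i`, where `E⁻¹ = 0`. If all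
`Eⁱ⁻¹(Zₘ)` have flat dimension at most `i - 1`, it follows that all `Eⁱ(Zₘ)` have flat dimension at
most `i`. This is an induction on `i` for all cycles simultaneously, so no boundedness of the complex
is needed (`hullsFlatDimLE_cycles`).

The statement on direct summands is `HullsFlatDimLE.of_shortExact`. The cokernel of
`Z → X → E⁰(X)` is an extension of `E⁰(X) / X` by `Z'`, extensions are handled by the horseshoe lemma
(`HullsFlatDimLE.extension`), and minimal injective copresentations are direct summands of arbitrary
ones (`IsRetractOf.hull_cosyzygy`).

The closure properties of modules of flat dimension at most `n` come from character modules: with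
`M⁺ = Hom_ℤ(M, ℚ/ℤ)`, a right module, `Hom_R(A, M⁺) = (A ⊗_R M)⁺` shows that `M` is flat if and only
if `M⁺` is injective, hence that the flat dimension of `M` is the injective dimension of `M⁺`
(`flatDimLE_iff_character`), and the latter is known to pass to direct summands and extensions.
-/

/-! ### Flat dimension and character modules -/

namespace AuslanderCondition

section Characters

variable {R : Type u} [Ring R]

/-- The right `R`-module structure on the character module of a left `R`-module, given by
`(c r) m = c (r m)`. -/
instance characterModuleOp (M : Type v) [AddCommGroup M] [Module R M] :
    Module Rᵐᵒᵖ (CharacterModule M) where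
  smul r c := AddMonoidHom.comp (c : M →+ AddCircle (1 : ℚ))
    (DistribSMul.toAddMonoidHom M r.unop)
  one_smul c := DFunLike.ext _ _ fun m => congrArg c (one_smul R m)
  mul_smul r s c := DFunLike.ext _ _ fun m => congrArg c (mul_smul s.unop r.unop m)
  smul_zero _ := rfl
  smul_add _ _ _ := rfl
  add_smul r s c := DFunLike.ext _ _ fun m =>
    (congrArg c (add_smul r.unop s.unop m)).trans (map_add c _ _)
  zero_smul c := DFunLike.ext _ _ fun m => (congrArg c (zero_smul R m)).trans (map_zero c)

variable {A M N P : Type v} [AddCommGroup A] [Module Rᵐᵒᵖ A] [AddCommGroup M] [Module R M]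
  [AddCommGroup N] [Module R N] [AddCommGroup P] [Module R P]

/-- The homomorphism of right `R`-modules `N⁺ → M⁺` dual to `f : M → N`. -/
def characterMap (f : M →ₗ[R] N) : CharacterModule N →ₗ[Rᵐᵒᵖ] CharacterModule M where
  toFun c := AddMonoidHom.comp (c : N →+ AddCircle (1 : ℚ)) f.toAddMonoidHom
  map_add' _ _ := rfl
  map_smul' r c := DFunLike.ext _ _ fun m => congrArg c (f.map_smul r.unop m).symm

/-- The divisible group `ℚ/ℤ` is injective, so characters extend. -/
theorem exists_character_extension {A B : Type v} [AddCommGroup A] [AddCommGroup B] (f : A →+ B)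
    (hf : Function.Injective f) (c : CharacterModule A) :
    ∃ c' : CharacterModule B, ∀ a, c' (f a) = c a := by
  obtain ⟨c', hc'⟩ := CharacterModule.dual_surjective_of_injective f.toIntLinearMap hf c
  exact ⟨c', fun a => DFunLike.congr_fun hc' a⟩

/-- A homomorphism `A → M⁺` of right `R`-modules gives a character of `A ⊗_R M`. -/
noncomputable def characterUncurry (g : A →ₗ[Rᵐᵒᵖ] CharacterModule M) :
    CharacterModule (BalancedTensor R A M) :=
  QuotientAddGroup.lift _
    (TensorProduct.liftAddHom (R := ℤ) (P := AddCircle (1 : ℚ))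
      (g.toAddMonoidHom : A →+ (M →+ AddCircle (1 : ℚ)))
      fun n a m => by
        change g (n • a) m = g a (n • m)
        rw [map_zsmul g, map_zsmul (g a)]; rfl)
    (by
      refine (AddSubgroup.closure_le _).2 ?_
      rintro _ ⟨a, r, m, rfl⟩
      change _ = _
      rw [map_sub, sub_eq_zero]
      change g (MulOpposite.op r • a) m = g a (r • m)
      rw [map_smul]; rfl)

theorem balancedTensor_op_smul (a : A) (r : R) (m : M) :
    (((MulOpposite.op r • a) ⊗ₜ[ℤ] m : A ⊗[ℤ] M) : BalancedTensor R A M) =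
      ((a ⊗ₜ[ℤ] (r • m) : A ⊗[ℤ] M) : BalancedTensor R A M) := by
  rw [← sub_eq_zero, ← QuotientAddGroup.mk_sub, QuotientAddGroup.eq_zero_iff]
  exact AddSubgroup.subset_closure ⟨a, r, m, rfl⟩

/-- A character of `A ⊗_R M` gives a homomorphism `A → M⁺` of right `R`-modules. -/
noncomputable def characterCurry (c : CharacterModule (BalancedTensor R A M)) :
    A →ₗ[Rᵐᵒᵖ] CharacterModule M where
  toFun a := AddMonoidHom.comp (c : BalancedTensor R A M →+ AddCircle (1 : ℚ))
    ((QuotientAddGroup.mk' _).comp (TensorProduct.mk ℤ A M a).toAddMonoidHom)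
  map_add' a b := DFunLike.ext _ _ fun m => by
    change c (((a + b) ⊗ₜ[ℤ] m : A ⊗[ℤ] M) : BalancedTensor R A M) =
      c ((a ⊗ₜ[ℤ] m : A ⊗[ℤ] M) : BalancedTensor R A M) +
        c ((b ⊗ₜ[ℤ] m : A ⊗[ℤ] M) : BalancedTensor R A M)
    rw [TensorProduct.add_tmul, QuotientAddGroup.mk_add, map_add]
  map_smul' r a := DFunLike.ext _ _ fun m => congrArg c (balancedTensor_op_smul a r.unop m)

theorem character_balancedTensor_ext {c c' : CharacterModule (BalancedTensor R A M)}
    (h : ∀ (a : A) (m : M), c ((a ⊗ₜ[ℤ] m : A ⊗[ℤ] M) : BalancedTensor R A M) =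
      c' ((a ⊗ₜ[ℤ] m : A ⊗[ℤ] M) : BalancedTensor R A M)) : c = c' := by
  refine DFunLike.ext _ _ fun x => ?_
  obtain ⟨t, rfl⟩ := QuotientAddGroup.mk_surjective x
  induction t with
  | zero => rw [QuotientAddGroup.mk_zero, map_zero, map_zero]
  | tmul a m => exact h a m
  | add s t hs ht => rw [QuotientAddGroup.mk_add, map_add, map_add, hs, ht]

/-- Lambek's criterion: since `Hom_R(A, M⁺) = (A ⊗_R M)⁺`, a module is flat exactly when its
character module is injective. -/
theorem isFlat_iff_injective_character :
    IsFlat R M ↔ Module.Injective Rᵐᵒᵖ (CharacterModule M) := by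
  refine ⟨fun h => ⟨fun A B _ _ _ _ f hf g => ?_⟩, fun h A B _ _ _ _ f hf => ?_⟩
  · obtain ⟨c, hc⟩ := exists_character_extension _ (h f hf) (characterUncurry g)
    exact ⟨characterCurry c, fun a => DFunLike.ext _ _ fun m =>
      hc ((a ⊗ₜ[ℤ] m : A ⊗[ℤ] M) : BalancedTensor R A M)⟩
  · rw [injective_iff_map_eq_zero]
    intro t ht
    refine CharacterModule.eq_zero_of_character_apply fun c => ?_
    obtain ⟨g, hg⟩ := h.out f hf (characterCurry c)
    have key : AddMonoidHom.comp
        (characterUncurry g : BalancedTensor R B M →+ AddCircle (1 : ℚ))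
        (BalancedTensor.map R M f) = c :=
      character_balancedTensor_ext (c := AddMonoidHom.comp
        (characterUncurry g : BalancedTensor R B M →+ AddCircle (1 : ℚ))
        (BalancedTensor.map R M f)) fun a m => DFunLike.congr_fun (hg a) m
    rw [← key]
    change characterUncurry g (BalancedTensor.map R M f t) = 0
    rw [ht, map_zero]

/-- Free modules are flat: a homomorphism `A → M⁺` is a family of characters of `A` indexed by a
basis of `M`, and each of these extends. -/
theorem isFlat_of_basis {ι : Type v} (b : Module.Basis ι R M) : IsFlat R M := by
  rw [isFlat_iff_injective_character]
  refine ⟨fun A B _ _ _ _ f hf g => ?_⟩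
  choose c hc using fun i => exists_character_extension f.toAddMonoidHom hf
    (AddMonoidHom.mk' (fun a => g a (b i)) fun x y => by rw [map_add]; rfl)
  -- The extension sends `y` to the character with `r bᵢ ↦ cᵢ (y r)`.
  let h : B →ₗ[Rᵐᵒᵖ] CharacterModule M :=
    { toFun := fun y => AddMonoidHom.comp (Finsupp.liftAddHom fun i =>
          AddMonoidHom.comp (c i : B →+ AddCircle (1 : ℚ)) (AddMonoidHom.mk'
            (fun r : R => MulOpposite.op r • y) fun r s => by rw [MulOpposite.op_add, add_smul]))
          b.repr.toLinearMap.toAddMonoidHom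
      map_add' := fun x y => DFunLike.ext _ _ fun m => by
        change ((b.repr m).sum fun i r => c i (MulOpposite.op r • (x + y))) =
          ((b.repr m).sum fun i r => c i (MulOpposite.op r • x)) +
          ((b.repr m).sum fun i r => c i (MulOpposite.op r • y))
        rw [← Finsupp.sum_add]
        simp only [smul_add, map_add]
      map_smul' := fun s y => DFunLike.ext _ _ fun m => by
        change ((b.repr m).sum fun i r => c i (MulOpposite.op r • s • y)) =
          ((b.repr (s.unop • m)).sum fun i r => c i (MulOpposite.op r • y))
        rw [map_smul, Finsupp.sum_smul_index (by simp)]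
        simp [MulOpposite.op_mul, mul_smul] }
  refine ⟨h, fun a => DFunLike.ext _ _ fun m => ?_⟩
  change ((b.repr m).sum fun i r => c i (MulOpposite.op r • f a)) = g a m
  conv_rhs => rw [← b.linearCombination_repr m, Finsupp.linearCombination_apply, Finsupp.sum,
    map_sum]
  refine Finset.sum_congr rfl fun i _ => ?_
  change c i (MulOpposite.op (b.repr m i) • f a) = g a (b.repr m i • b i)
  rw [← map_smul f]
  refine (hc i _).trans ?_
  change g (MulOpposite.op (b.repr m i) • a) (b i) = _
  rw [map_smul]; rfl

theorem characterMap_shortExact {K F : Type v} [AddCommGroup K] [Module R K] [AddCommGroup F]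
    [Module R F] (i : K →ₗ[R] F) (p : F →ₗ[R] M) (hi : Function.Injective i)
    (hip : Function.Exact i p) (hp : Function.Surjective p) :
    ∃ w, (ShortComplex.mk (ModuleCat.ofHom (characterMap p)) (ModuleCat.ofHom (characterMap i))
      w).ShortExact := by
  have hex : Function.Exact (characterMap p) (characterMap i) := by
    intro c
    constructor
    · intro hc
      -- A character vanishing on the image of `i` descends along `p`.
      have hker : p.toAddMonoidHom.ker ≤ (c : F →+ AddCircle (1 : ℚ)).ker := fun x hx => by
        obtain ⟨k, rfl⟩ := (hip x).1 hx
        exact DFunLike.congr_fun hc k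
      refine ⟨p.toAddMonoidHom.liftOfSurjective hp ⟨c, hker⟩, DFunLike.ext _ _ fun x => ?_⟩
      exact p.toAddMonoidHom.liftOfRightInverse_comp_apply _ (Function.rightInverse_surjInv hp)
        ⟨(c : F →+ _), hker⟩ x
    · rintro ⟨c, rfl⟩
      refine DFunLike.ext _ _ fun k => ?_
      change c (p (i k)) = 0
      rw [hip.apply_apply_eq_zero, map_zero]
  refine ⟨?_, ModuleCat.shortComplex_shortExact _ hex ?_ ?_⟩
  · ext c : 2
    exact hex.apply_apply_eq_zero c
  · intro c c' h
    refine DFunLike.ext _ _ fun m => ?_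
    obtain ⟨x, rfl⟩ := hp m
    exact DFunLike.congr_fun h x
  · intro c
    obtain ⟨c', hc'⟩ := exists_character_extension i.toAddMonoidHom hi c
    exact ⟨c', DFunLike.ext _ _ hc'⟩

variable [Small.{v} R]

theorem exists_flat_presentation (M : Type v) [AddCommGroup M] [Module R M] :
    ∃ (K F : ModuleCat.{v} R) (i : K →ₗ[R] F) (p : F →ₗ[R] M),
      IsFlat R F ∧ Function.Injective i ∧ Function.Exact i p ∧ Function.Surjective p := by
  -- `Shrink R` brings the free module on the set `M` down to the universe of `M`.
  let b : Module.Basis M R (M →₀ Shrink.{v} R) :=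
    ⟨Finsupp.mapRange.linearEquiv (Shrink.linearEquiv R R)⟩
  let p : (M →₀ Shrink.{v} R) →ₗ[R] M := b.constr ℕ id
  exact ⟨ModuleCat.of R (LinearMap.ker p), ModuleCat.of R (M →₀ Shrink.{v} R),
    (LinearMap.ker p).subtype, p, isFlat_of_basis b, Subtype.val_injective,
    LinearMap.exact_subtype_ker_map p, fun m => ⟨b m, b.constr_basis ℕ id m⟩⟩

/-- Dimension shifting along a flat presentation: the flat dimension of `M` is the injective
dimension of its character module. -/
theorem flatDimLE_iff_character (n : ℕ) (M : Type v) [AddCommGroup M] [Module R M] :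
    FlatDimLE R n M ↔
      HasInjectiveDimensionLT (ModuleCat.of Rᵐᵒᵖ (CharacterModule M)) (n + 1) := by
  have hflat (F : Type v) [AddCommGroup F] [Module R F] :
      IsFlat R F ↔ Injective (ModuleCat.of Rᵐᵒᵖ (CharacterModule F)) :=
    isFlat_iff_injective_character.trans (Module.injective_iff_injective_object _ _)
  induction n generalizing M with
  | zero => exact (hflat M).trans injective_iff_hasInjectiveDimensionLT_one
  | succ n ih =>
    constructor
    · rintro ⟨K, F, i, p, hF, hi, hip, hp, hK⟩
      obtain ⟨w, hS⟩ := characterMap_shortExact i p hi hip hp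
      exact (hS.hasInjectiveDimensionLT_X₃_iff n ((hflat F).1 hF)).1 ((ih K).1 hK)
    · intro h
      obtain ⟨K, F, i, p, hF, hi, hip, hp⟩ := exists_flat_presentation (R := R) M
      obtain ⟨w, hS⟩ := characterMap_shortExact i p hi hip hp
      exact ⟨K, F, i, p, hF, hi, hip, hp,
        (ih K).2 ((hS.hasInjectiveDimensionLT_X₃_iff n ((hflat F).1 hF)).2 h)⟩

theorem FlatDimLE.mono {m n : ℕ} (h : FlatDimLE R m M) (hmn : m ≤ n) : FlatDimLE R n M := by
  rw [flatDimLE_iff_character] at h ⊢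
  exact hasInjectiveDimensionLT_of_ge _ (m + 1) _ (by lia)

theorem FlatDimLE.of_retract {n : ℕ} (h : FlatDimLE R n N) (s : M →ₗ[R] N) (r : N →ₗ[R] M)
    (hrs : r ∘ₗ s = LinearMap.id) : FlatDimLE R n M := by
  rw [flatDimLE_iff_character] at h ⊢
  refine Retract.hasInjectiveDimensionLT (Y := ModuleCat.of Rᵐᵒᵖ (CharacterModule N))
    ⟨ModuleCat.ofHom (characterMap r), ModuleCat.ofHom (characterMap s), ?_⟩ _
  ext c : 2
  exact DFunLike.ext _ _ fun m => congrArg c (LinearMap.congr_fun hrs m)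

theorem FlatDimLE.of_shortExact {n : ℕ} (hM : FlatDimLE R n M) (hP : FlatDimLE R n P)
    (i : M →ₗ[R] N) (p : N →ₗ[R] P) (hi : Function.Injective i) (hip : Function.Exact i p)
    (hp : Function.Surjective p) : FlatDimLE R n N := by
  rw [flatDimLE_iff_character] at *
  obtain ⟨w, hS⟩ := characterMap_shortExact i p hi hip hp
  exact hS.hasInjectiveDimensionLT_X₂ _ hP hM

theorem FlatDimLE.prod {n : ℕ} (hM : FlatDimLE R n M) (hN : FlatDimLE R n N) :
    FlatDimLE R n (M × N) :=
  hM.of_shortExact hN (LinearMap.inl R M N) (LinearMap.snd R M N) LinearMap.inl_injective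
    Function.Exact.inl_snd LinearMap.snd_surjective

end Characters

end AuslanderCondition

/-! ### Injective envelopes and cosyzygies -/

namespace AuslanderCondition

section Hulls

variable {R : Type u} [Ring R]

theorem injective_of_retract {M N : Type v} [AddCommGroup M] [Module R M] [AddCommGroup N]
    [Module R N] (hN : Module.Injective R N) (s : M →ₗ[R] N) (r : N →ₗ[R] M)
    (hrs : ∀ x, r (s x) = x) : Module.Injective R M := by
  refine ⟨fun X Y _ _ _ _ f hf g => ?_⟩
  obtain ⟨h, hh⟩ := hN.out f hf (s ∘ₗ g)
  exact ⟨r ∘ₗ h, fun x => by simp [hh, hrs]⟩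

/-- A submodule that is maximal among the essential extensions of `N` inside an injective module is
a direct summand, hence injective. -/
theorem injective_of_maximal_essential {I : Type v} [AddCommGroup I] [Module R I]
    (hI : Module.Injective R I) {N E : Submodule R I}
    (hE : Maximal (fun E => N ≤ E ∧ ∀ K ≤ E, K ⊓ N = ⊥ → K = ⊥) E) : Module.Injective R E := by
  -- With `C` maximal such that `E ⊓ C = ⊥`, the module `I ⧸ C` is an essential extension of `E`;
  -- injectivity of `I` gives `q : I → I` that is the identity on `E` and vanishes on `C`.
  obtain ⟨C, -, hC⟩ := zorn_le_nonempty₀ {C : Submodule R I | Disjoint E C}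
    (fun c hc hchain _ _ => ⟨sSup c, hchain.directedOn.disjoint_sSup_right.2 fun _ h => hc h,
      fun _ => le_sSup⟩) ⊥ disjoint_bot_right
  have hCE : Function.Injective (C.mkQ ∘ₗ E.subtype) := by
    rw [← LinearMap.ker_eq_bot, LinearMap.ker_comp, Submodule.ker_mkQ]
    exact Submodule.disjoint_iff_comap_eq_bot.1 hC.prop
  obtain ⟨h, hh⟩ := hI.out _ hCE E.subtype
  let q : I →ₗ[R] I := h ∘ₗ C.mkQ
  have hqE (x : I) (hx : x ∈ E) : q x = x := hh ⟨x, hx⟩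
  have hqC (x : I) (hx : x ∈ C) : q x = 0 := by
    simp [q, (Submodule.Quotient.mk_eq_zero C).2 hx]
  have hle : E ≤ LinearMap.range q := fun x hx => ⟨x, hqE x hx⟩
  -- By maximality of `C`, the range of `q` is again an essential extension of `N`.
  have hmax : LinearMap.range q ≤ E := by
    refine hE.2 ⟨hE.prop.1.trans hle, fun K hK hKN => ?_⟩ hle
    have hKE : K ⊓ E = ⊥ := hE.prop.2 _ inf_le_right
      (le_bot_iff.1 ((inf_le_inf_right _ inf_le_left).trans hKN.le))
    have hKC : K.comap q ≤ C := by
      refine hC.2 ?_ fun x hx => ?_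
      · refine Submodule.disjoint_def.2 fun x hx hxK => ?_
        have : x ∈ K ⊓ E := ⟨by simpa [hqE x hx] using hxK, hx⟩
        simpa [hKE] using this
      · simp [hqC x hx]
    refine (Submodule.eq_bot_iff _).2 fun k hk => ?_
    obtain ⟨x, rfl⟩ := hK hk
    exact hqC x (hKC hk)
  exact injective_of_retract hI E.subtype (q.codRestrict E fun x => hmax ⟨x, rfl⟩)
    fun x => Subtype.ext (hqE x x.2)

theorem exists_descend {M N P : Type v} [AddCommGroup M] [Module R M] [AddCommGroup N]
    [Module R N] [AddCommGroup P] [Module R P] (p : M →ₗ[R] N) (hp : Function.Surjective p)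
    (g : M →ₗ[R] P) (h : ∀ x, p x = 0 → g x = 0) : ∃ g' : N →ₗ[R] P, ∀ x, g' (p x) = g x := by
  refine ⟨(LinearMap.ker p).liftQ g h ∘ₗ (p.quotKerEquivOfSurjective hp).symm, fun x => ?_⟩
  have : (p.quotKerEquivOfSurjective hp).symm (p x) = (LinearMap.ker p).mkQ x := by
    rw [LinearEquiv.symm_apply_eq]; rfl
  simp only [LinearMap.comp_apply, LinearEquiv.coe_coe, this]
  exact Submodule.liftQ_apply _ _ _

/-- `M` is isomorphic to a direct summand of `N`. -/
def IsRetractOf (M N : ModuleCat.{v} R) : Prop :=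
  ∃ (s : M →ₗ[R] N) (r : N →ₗ[R] M), ∀ x, r (s x) = x

theorem IsRetractOf.refl (M : ModuleCat.{v} R) : IsRetractOf M M :=
  ⟨LinearMap.id, LinearMap.id, fun _ => rfl⟩

variable [Small.{v} R]

theorem exists_injective_hull (M : ModuleCat.{v} R) :
    ∃ (E : ModuleCat.{v} R) (ι : M →ₗ[R] E), Module.Injective R E ∧ Function.Injective ι ∧
      IsEssential (LinearMap.range ι) := by
  -- Embed `M` into an injective module, and take a maximal essential extension inside it.
  obtain ⟨P⟩ := EnoughInjectives.presentation M
  let I := P.J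
  let j : M →ₗ[R] I := P.f.hom
  have hj : Function.Injective j := (ModuleCat.mono_iff_injective P.f).1 inferInstance
  have hI : Module.Injective R I :=
    (Module.injective_iff_injective_object R I).2 P.injective
  obtain ⟨E, -, hE⟩ := zorn_le_nonempty₀
    {E : Submodule R I | LinearMap.range j ≤ E ∧
      ∀ K ≤ E, K ⊓ LinearMap.range j = ⊥ → K = ⊥}
    (fun c hc hchain E₀ hE₀ => by
      refine ⟨sSup c, ⟨(hc hE₀).1.trans (le_sSup hE₀), fun K hK hKN => ?_⟩, fun _ => le_sSup⟩
      refine (Submodule.eq_bot_iff _).2 fun k hk => ?_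
      -- It is enough to look at cyclic submodules, which lie in one member of the chain.
      obtain ⟨E, hE, hkE⟩ := (Submodule.mem_sSup_of_directed ⟨E₀, hE₀⟩ hchain.directedOn).1 (hK hk)
      refine Submodule.span_singleton_eq_bot.1 ((hc hE).2 _ ?_ (le_bot_iff.1 ?_))
      · simpa using hkE
      · exact (inf_le_inf_right _ (by simpa using hk)).trans hKN.le)
    (LinearMap.range j) ⟨le_rfl, fun K hK hKN => by rwa [inf_eq_left.2 hK] at hKN⟩
  refine ⟨ModuleCat.of R E, j.codRestrict E fun x => hE.prop.1 ⟨x, rfl⟩,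
    injective_of_maximal_essential hI hE, fun x y h => hj (congrArg Subtype.val h), ?_⟩
  intro K hK
  have hKj : K.map E.subtype ⊓ LinearMap.range j = ⊥ := by
    refine (Submodule.eq_bot_iff _).2 ?_
    rintro _ ⟨⟨k, hk, rfl⟩, m, hm⟩
    have : k ∈ K ⊓ LinearMap.range (j.codRestrict E fun x => hE.prop.1 ⟨x, rfl⟩) :=
      ⟨hk, m, Subtype.ext hm⟩
    rw [hK] at this
    simp [(Submodule.mem_bot R).1 this]
  have := hE.prop.2 _ (Submodule.map_subtype_le E K) hKj
  exact Submodule.map_injective_of_injective E.injective_subtype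
    (this.trans (Submodule.map_bot _).symm)

/-- An injective envelope `E⁰(M)` of `M`. -/
noncomputable def hull (M : ModuleCat.{v} R) : ModuleCat.{v} R :=
  (exists_injective_hull M).choose

/-- The inclusion of `M` into its injective envelope. -/
noncomputable def toHull (M : ModuleCat.{v} R) : M →ₗ[R] hull M :=
  (exists_injective_hull M).choose_spec.choose

theorem hull_injective (M : ModuleCat.{v} R) : Module.Injective R (hull M) :=
  (exists_injective_hull M).choose_spec.choose_spec.1

theorem toHull_injective (M : ModuleCat.{v} R) : Function.Injective (toHull M) :=
  (exists_injective_hull M).choose_spec.choose_spec.2.1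

theorem toHull_essential (M : ModuleCat.{v} R) : IsEssential (LinearMap.range (toHull M)) :=
  (exists_injective_hull M).choose_spec.choose_spec.2.2

/-- The cosyzygy `E⁰(M) / M` of `M`. -/
noncomputable abbrev cosyzygy (M : ModuleCat.{v} R) : ModuleCat.{v} R :=
  ModuleCat.of R (hull M ⧸ LinearMap.range (toHull M))

/-- A minimal injective copresentation is a direct summand of any other one, and this holds more
generally when the module is a direct summand of the other one. -/
theorem IsRetractOf.hull_cosyzygy {M N I C : ModuleCat.{v} R} (hMN : IsRetractOf M N)
    (hI : Module.Injective R I) (j : N →ₗ[R] I) (p : I →ₗ[R] C) (hj : Function.Injective j)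
    (hjp : Function.Exact j p) (hp : Function.Surjective p) :
    IsRetractOf (hull M) I ∧ IsRetractOf (cosyzygy M) C := by
  obtain ⟨s, r, hrs⟩ := hMN
  obtain ⟨f, hf⟩ := hI.out (toHull M) (toHull_injective M) (j ∘ₗ s)
  obtain ⟨g, hg⟩ := (hull_injective M).out j hj (toHull M ∘ₗ r)
  have hgf (m : M) : g (f (toHull M m)) = toHull M m := by simp [hf, hg, hrs]
  -- The endomorphism `g ∘ f` is the identity on the essential submodule `M`.
  have hinj : Function.Injective (g ∘ₗ f) := by
    rw [← LinearMap.ker_eq_bot]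
    refine toHull_essential M _ ((Submodule.eq_bot_iff _).2 ?_)
    rintro _ ⟨hx, m, rfl⟩
    rw [← hgf m]
    exact hx
  obtain ⟨β, hβ⟩ := (hull_injective M).out _ hinj LinearMap.id
  have hβM (m : M) : β (toHull M m) = toHull M m := by
    conv_lhs => rw [← hgf m]
    exact hβ _
  obtain ⟨s', hs'⟩ := exists_descend (LinearMap.range (toHull M)).mkQ
    (Submodule.mkQ_surjective _) (p ∘ₗ f) (by
      intro x hx
      obtain ⟨m, rfl⟩ := (Submodule.Quotient.mk_eq_zero _).1 hx
      simp [hf, hjp.apply_apply_eq_zero])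
  obtain ⟨r', hr'⟩ := exists_descend p hp ((LinearMap.range (toHull M)).mkQ ∘ₗ β ∘ₗ g) (by
    intro x hx
    obtain ⟨y, rfl⟩ := (hjp x).1 hx
    refine (Submodule.Quotient.mk_eq_zero _).2 ⟨r y, ?_⟩
    simp [hg, hβM])
  refine ⟨⟨f, β ∘ₗ g, hβ⟩, s', r', fun x => ?_⟩
  obtain ⟨x, rfl⟩ := Submodule.mkQ_surjective _ x
  rw [hs']
  exact (hr' _).trans (congrArg _ (hβ x))

end Hulls
end AuslanderCondition

/-! ### Flat dimensions along minimal injective coresolutions -/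

namespace AuslanderCondition

section Coresolutions

variable {R : Type u} [Ring R]

/-- In an acyclic complex, `0 → Zₙ → Xₙ → Zₙ₋₁ → 0` is exact, where `Zₙ` is the `n`-th cycle. -/
theorem cycles_shortExact (X : ChainComplex (ModuleCat.{v} R) ℤ) (hX : X.Acyclic) (n : ℤ) :
    ∃ (i : X.cycles n →ₗ[R] X.X n) (p : X.X n →ₗ[R] X.cycles (n - 1)),
      Function.Injective i ∧ Function.Exact i p ∧ Function.Surjective p := by
  have hinj (m : ℤ) : Function.Injective (X.iCycles m).hom :=
    (ModuleCat.mono_iff_injective _).1 inferInstance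
  have hto (x : X.X n) : (X.iCycles (n - 1)).hom ((X.toCycles n (n - 1)).hom x) =
      (X.d n (n - 1)).hom x :=
    congr($(X.toCycles_i n (n - 1)).hom x)
  have hker (m : ℤ) : (ShortComplex.mk _ _ (X.iCycles_d m (m - 1))).Exact :=
    ShortComplex.exact_of_f_is_kernel _ (X.cyclesIsKernel m (m - 1) (by simp))
  have hex : (X.sc' n (n - 1) (n - 1 - 1)).Exact :=
    (X.exactAt_iff' n (n - 1) (n - 1 - 1) (by simp) (by simp)).1 (hX (n - 1))
  refine ⟨(X.iCycles n).hom, (X.toCycles n (n - 1)).hom, hinj n, fun x => ?_, fun z => ?_⟩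
  · rw [← map_eq_zero_iff _ (hinj (n - 1)), hto]
    exact (ShortComplex.ShortExact.moduleCat_exact_iff_function_exact _).1 (hker n) x
  · have hz : (X.d (n - 1) (n - 1 - 1)).hom ((X.iCycles (n - 1)).hom z) = 0 :=
      congr($(X.iCycles_d (n - 1) (n - 1 - 1)).hom z)
    obtain ⟨x, hx⟩ := (ShortComplex.moduleCat_exact_iff _).1 hex _ hz
    exact ⟨x, hinj _ ((hto x).trans hx)⟩

variable [Small.{v} R]

/-- `HullsFlatDimLE n k M` says that the first `n` terms `E⁰(M), …, Eⁿ⁻¹(M)` of the minimal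
injective coresolution of `M` have flat dimensions at most `k, k + 1, …, k + n - 1`. The shift `k`
is what makes the recursion through the cosyzygy possible. -/
def HullsFlatDimLE : ℕ → ℕ → ModuleCat.{v} R → Prop
  | 0, _, _ => True
  | n + 1, k, M => FlatDimLE R k (hull M) ∧ HullsFlatDimLE n (k + 1) (cosyzygy M)

namespace HullsFlatDimLE

theorem mono {n k l : ℕ} {M : ModuleCat.{v} R} (h : HullsFlatDimLE n k M) (hkl : k ≤ l) :
    HullsFlatDimLE n l M := by
  induction n generalizing k l M with
  | zero => trivial
  | succ n ih => exact ⟨h.1.mono hkl, ih h.2 (by lia)⟩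

/-- The bounds may be checked on any injective copresentation, not only on the minimal one, of a
module having `M` as a direct summand. -/
theorem of_retract_copresentation {n k : ℕ} {M N I C : ModuleCat.{v} R} (hMN : IsRetractOf M N)
    (hI : Module.Injective R I) (j : N →ₗ[R] I) (p : I →ₗ[R] C) (hj : Function.Injective j)
    (hjp : Function.Exact j p) (hp : Function.Surjective p) (hIk : FlatDimLE R k I)
    (hC : HullsFlatDimLE n (k + 1) C) : HullsFlatDimLE (n + 1) k M := by
  induction n generalizing k M N I C with
  | zero =>
    obtain ⟨⟨s, r, hrs⟩, -⟩ := hMN.hull_cosyzygy hI j p hj hjp hp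
    exact ⟨hIk.of_retract s r (LinearMap.ext hrs), trivial⟩
  | succ n ih =>
    obtain ⟨⟨s, r, hrs⟩, hret⟩ := hMN.hull_cosyzygy hI j p hj hjp hp
    exact ⟨hIk.of_retract s r (LinearMap.ext hrs), ih hret (hull_injective C) (toHull C)
      (LinearMap.range (toHull C)).mkQ (toHull_injective C) (LinearMap.exact_map_mkQ_range _)
      (Submodule.mkQ_surjective _) hC.1 hC.2⟩

theorem of_embedding {n k : ℕ} {M I : ModuleCat.{v} R} (hI : Module.Injective R I)
    (j : M →ₗ[R] I) (hj : Function.Injective j) (hIk : FlatDimLE R k I)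
    (hC : HullsFlatDimLE n (k + 1) (ModuleCat.of R (I ⧸ LinearMap.range j))) :
    HullsFlatDimLE (n + 1) k M :=
  of_retract_copresentation (IsRetractOf.refl M) hI j (LinearMap.range j).mkQ hj
    (LinearMap.exact_map_mkQ_range _) (Submodule.mkQ_surjective _) hIk hC

/-- By the horseshoe lemma, the bounds are inherited by extensions. -/
theorem extension {n k : ℕ} {A B C : ModuleCat.{v} R} (hA : HullsFlatDimLE n k A)
    (hC : HullsFlatDimLE n k C) (i : A →ₗ[R] B) (p : B →ₗ[R] C) (hi : Function.Injective i)
    (hip : Function.Exact i p) (hp : Function.Surjective p) : HullsFlatDimLE n k B := by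
  induction n generalizing k A B C with
  | zero => trivial
  | succ n ih =>
    have hIA := hull_injective A
    have hIC := hull_injective C
    obtain ⟨f, hf⟩ := hIA.out i hi (toHull A)
    let j : B →ₗ[R] hull A × hull C := f.prod (toHull C ∘ₗ p)
    have hj : Function.Injective j := by
      rw [injective_iff_map_eq_zero]
      intro b hb
      have h2 : p b = 0 := (map_eq_zero_iff _ (toHull_injective C)).1 (congrArg Prod.snd hb)
      obtain ⟨a, rfl⟩ := (hip b).1 h2
      have h1 : toHull A a = 0 := (hf a).symm.trans (congrArg Prod.fst hb)
      rw [(map_eq_zero_iff _ (toHull_injective A)).1 h1, map_zero]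
    have hI : Module.Injective R (hull A × hull C) := by
      refine ⟨fun X Y _ _ _ _ g hg h => ?_⟩
      obtain ⟨h₁, hh₁⟩ := hIA.out g hg (LinearMap.fst R _ _ ∘ₗ h)
      obtain ⟨h₂, hh₂⟩ := hIC.out g hg (LinearMap.snd R _ _ ∘ₗ h)
      exact ⟨h₁.prod h₂, fun x => Prod.ext (hh₁ x) (hh₂ x)⟩
    refine of_embedding (I := ModuleCat.of R (hull A × hull C)) hI j hj (hA.1.prod hC.1) ?_
    have h₁ : LinearMap.range (toHull A) ≤ (LinearMap.range j).comap
        (LinearMap.inl R (hull A) (hull C)) := by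
      rintro _ ⟨a, rfl⟩
      exact ⟨i a, Prod.ext (hf a) (by simp [j, hip.apply_apply_eq_zero])⟩
    have h₂ : LinearMap.range j ≤ (LinearMap.range (toHull C)).comap
        (LinearMap.snd R (hull A) (hull C)) := by
      rintro _ ⟨b, rfl⟩
      exact ⟨p b, rfl⟩
    refine ih hA.2 hC.2 (Submodule.mapQ _ _ _ h₁) (Submodule.mapQ _ _ _ h₂) ?_ ?_ ?_
    · rw [injective_iff_map_eq_zero]
      intro x hx
      obtain ⟨x, rfl⟩ := Submodule.mkQ_surjective _ x
      obtain ⟨b, hb⟩ := (Submodule.Quotient.mk_eq_zero _).1 hx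
      have h2 : p b = 0 := (map_eq_zero_iff _ (toHull_injective C)).1 (congrArg Prod.snd hb)
      obtain ⟨a, rfl⟩ := (hip b).1 h2
      exact (Submodule.Quotient.mk_eq_zero _).2 ⟨a, (hf a).symm.trans (congrArg Prod.fst hb)⟩
    · intro y
      obtain ⟨⟨x, y⟩, rfl⟩ := Submodule.mkQ_surjective _ y
      constructor
      · intro hy
        obtain ⟨c, hc⟩ := (Submodule.Quotient.mk_eq_zero _).1 hy
        obtain ⟨b, rfl⟩ := hp c
        refine ⟨(LinearMap.range (toHull A)).mkQ (x - f b), (Submodule.Quotient.eq _).2 ⟨-b, ?_⟩⟩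
        refine Prod.ext ?_ ?_
        · simp [j]
        · simpa [j] using hc
      · rintro ⟨z, hz⟩
        obtain ⟨z, rfl⟩ := Submodule.mkQ_surjective _ z
        rw [← hz]
        exact (Submodule.Quotient.mk_eq_zero _).2 (by simp)
    · intro y
      obtain ⟨y, rfl⟩ := Submodule.mkQ_surjective _ y
      exact ⟨(LinearMap.range j).mkQ (0, y), rfl⟩

/-- If `0 → Z → X → Z' → 0` is exact, then `Eⁱ(Z)` is a direct summand of `Eⁱ(X) ⊕ Eⁱ⁻¹(Z')`:
the cokernel of `Z → E⁰(X)` is an extension of the cosyzygy of `X` by `Z'`. -/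
theorem of_shortExact {n k : ℕ} {Z X Z' : ModuleCat.{v} R} (hX : HullsFlatDimLE (n + 1) k X)
    (hZ' : HullsFlatDimLE n (k + 1) Z') (i : Z →ₗ[R] X) (p : X →ₗ[R] Z')
    (hi : Function.Injective i) (hip : Function.Exact i p) (hp : Function.Surjective p) :
    HullsFlatDimLE (n + 1) k Z := by
  refine of_embedding (hull_injective X) (toHull X ∘ₗ i) ((toHull_injective X).comp hi) hX.1 ?_
  obtain ⟨a, ha⟩ := exists_descend p hp
    ((LinearMap.range (toHull X ∘ₗ i)).mkQ ∘ₗ toHull X) (by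
      intro x hx
      obtain ⟨z, rfl⟩ := (hip x).1 hx
      exact (Submodule.Quotient.mk_eq_zero _).2 ⟨z, rfl⟩)
  refine extension hZ' hX.2 a (Submodule.factor (LinearMap.range_comp_le_range i (toHull X)))
    ?_ ?_ ?_
  · rw [injective_iff_map_eq_zero]
    intro z hz
    obtain ⟨x, rfl⟩ := hp z
    rw [ha] at hz
    obtain ⟨y, hy⟩ := (Submodule.Quotient.mk_eq_zero _).1 hz
    rw [← toHull_injective X hy, hip.apply_apply_eq_zero]
  · intro y
    obtain ⟨y, rfl⟩ := Submodule.mkQ_surjective _ y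
    constructor
    · intro hy
      obtain ⟨x, rfl⟩ := (Submodule.Quotient.mk_eq_zero _).1 hy
      exact ⟨p x, ha x⟩
    · rintro ⟨z, hz⟩
      obtain ⟨x, rfl⟩ := hp z
      rw [← hz, ha]
      exact (Submodule.Quotient.mk_eq_zero _).2 ⟨x, rfl⟩
  · intro y
    obtain ⟨y, rfl⟩ := Submodule.mkQ_surjective _ y
    exact ⟨(LinearMap.range (toHull X ∘ₗ i)).mkQ y, rfl⟩

/-- The bounds may be checked on any injective coresolution: minimality is not needed. -/
theorem of_coresolution {n k : ℕ} {M : ModuleCat.{v} R} (E : ℕ → ModuleCat.{v} R)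
    (ε : M →ₗ[R] E 0) (d : ∀ i, E i →ₗ[R] E (i + 1)) (hE : ∀ i, Module.Injective R (E i))
    (hε : Function.Injective ε) (h₀ : Function.Exact ε (d 0))
    (hd : ∀ i, Function.Exact (d i) (d (i + 1))) (hk : ∀ i, FlatDimLE R (k + i) (E i)) :
    HullsFlatDimLE n k M := by
  induction n generalizing k M E with
  | zero => trivial
  | succ n ih =>
    refine of_retract_copresentation (C := ModuleCat.of R (LinearMap.range (d 0)))
      (IsRetractOf.refl M) (hE 0) ε (d 0).rangeRestrict hε ?_
      (d 0).surjective_rangeRestrict (hk 0) ?_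
    · intro x
      rw [← h₀ x]
      exact Subtype.ext_iff
    · refine ih (fun i => E (i + 1)) (LinearMap.range (d 0)).subtype (fun i => d (i + 1))
        (fun i => hE (i + 1)) Subtype.val_injective ?_ (fun i => hd (i + 1)) fun i => ?_
      · intro x
        rw [hd 0 x]
        simp
      · rw [Nat.add_right_comm]
        exact hk (i + 1)

end HullsFlatDimLE

/-- The iterated cosyzygies of `M`. -/
noncomputable def iteratedCosyzygy (M : ModuleCat.{v} R) : ℕ → ModuleCat.{v} R
  | 0 => M
  | i + 1 => cosyzygy (iteratedCosyzygy M i)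

/-- The minimal injective coresolution of `M` consists of the injective envelopes of its iterated
cosyzygies. -/
theorem satisfiesAuslanderCondition_iff (M : ModuleCat.{v} R) :
    SatisfiesAuslanderCondition R M ↔ ∀ n, HullsFlatDimLE n 0 M := by
  constructor
  · rintro ⟨E, ε, d, h, hfd⟩ n
    exact .of_coresolution E ε d h.injective h.injective_ε h.exact_zero h.exact_succ
      (by simpa using hfd)
  · intro h
    have hmk (i : ℕ) : Function.Surjective
      (LinearMap.range (toHull (iteratedCosyzygy M i))).mkQ := Submodule.mkQ_surjective _
    let d (i : ℕ) : hull (iteratedCosyzygy M i) →ₗ[R] hull (iteratedCosyzygy M (i + 1)) :=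
      toHull (iteratedCosyzygy M (i + 1)) ∘ₗ (LinearMap.range (toHull (iteratedCosyzygy M i))).mkQ
    have hrange (i : ℕ) : LinearMap.range (d i) =
        LinearMap.range (toHull (iteratedCosyzygy M (i + 1))) :=
      LinearMap.range_comp_of_range_eq_top _ (LinearMap.range_eq_top.2 (hmk i))
    have hker (i : ℕ) : LinearMap.ker (d i) = LinearMap.range (toHull (iteratedCosyzygy M i)) :=
      (LinearMap.ker_comp_of_ker_eq_bot _
        (LinearMap.ker_eq_bot.2 (toHull_injective _))).trans (Submodule.ker_mkQ _)
    have hex (i : ℕ) : Function.Exact (toHull (iteratedCosyzygy M i)) (d i) :=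
      LinearMap.exact_iff.2 (hker i)
    refine ⟨fun i => hull (iteratedCosyzygy M i), toHull M, d,
      ⟨fun i => hull_injective _, toHull_injective M, hex 0,
        fun i => LinearMap.exact_iff.2 ((hker (i + 1)).trans (hrange i).symm),
        toHull_essential M, fun i => ?_⟩, fun i => ?_⟩
    · rw [hrange]
      exact toHull_essential _
    · have key (i : ℕ) : ∀ n, HullsFlatDimLE n i (iteratedCosyzygy M i) := by
        induction i with
        | zero => exact h
        | succ i ih => exact fun n => (ih (n + 1)).2
      exact (key i 1).1

/-- Each cycle inherits the bounds on its first `m + 1` terms from those on the first `m` terms of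
the next cycle, so the induction on `m` runs over all cycles at once. -/
theorem hullsFlatDimLE_cycles (X : ChainComplex (ModuleCat.{v} R) ℤ) (hX : X.Acyclic)
    (hAC : ∀ n : ℤ, SatisfiesAuslanderCondition R (X.X n)) (m : ℕ) (n : ℤ) :
    HullsFlatDimLE m 0 (X.cycles n) := by
  induction m generalizing n with
  | zero => trivial
  | succ m ih =>
    obtain ⟨i, p, hi, hip, hp⟩ := cycles_shortExact X hX n
    exact .of_shortExact ((satisfiesAuslanderCondition_iff _).1 (hAC n) (m + 1))
      ((ih (n - 1)).mono zero_le_one) i p hi hip hp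

end Coresolutions

end AuslanderCondition

theorem proposition3p2 (R : Type u) [Ring R] [Small.{v} R]
    (X : ChainComplex (ModuleCat.{v} R) ℤ) (hX : X.Acyclic)
    (hAC : ∀ n : ℤ, AuslanderCondition.SatisfiesAuslanderCondition R (X.X n)) (n : ℤ) :
    AuslanderCondition.SatisfiesAuslanderCondition R (X.cycles n) :=
  (AuslanderCondition.satisfiesAuslanderCondition_iff _).2 fun m =>
    AuslanderCondition.hullsFlatDimLE_cycles X hX hAC m n
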